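/- Fix $q\in(0,1)$. For real $c$ and $m\in\mathbb{N}_0$ let $(c;q)_m=\prod_{i=0}^{m-1}(1-cq^i)$. For $n\ge 0$, $b\in\mathbb{R}$ and $a\in\mathbb{R}\setminus\{q^{-1},\dots,q^{-n}\}$ let $$p_n(x;a,b)={}_2\phi_1\!\left(\begin{matrix}q^{-n},\,abq^{n+1}\\ aq\end{matrix};q,qx\right)=\sum_{i=0}^{n}\frac{(q^{-n};q)_i\,(abq^{n+1};q)_i}{(aq;q)_i\,(q;q)_i}\,(qx)^i$$ be the little $q$-Jacobi polynomial. Let $n\ge 1$ and $k\in\{1,\dots,n\}$, and set $E_k(x)=\prod_{j=1}^k(1-q^{-j}x)$. Then: (1) $E_k(x)={}_1\phi_0(q^{-k};\cdot\,;q,x)=\sum_{i=0}^k\frac{(q^{-k};q)_i}{(q;q)_i}x^i$. (2) For every $a\in\mathbb{R}\setminus\{q^{-1},\dots,q^{-n}\}$, $$p_n(x;a,q^{-k})=E_k(qx)\;p_{n-k}(q^{-k}x;a,q^k)$$ as polynomials in $x$. (3) If $0<aq<1$, then $p_n(x;a,q^{-k})$ has degree exactly $n$, all its complex zeros are real and lie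 in $(0,1]$, and its logarithmic mesh is at most $q$: if $\lambda_1\le\dots\le\lambda_n$ are its zeros counted with multiplicity, then $\max_{1\le j\le n-1}\lambda_j/\lambda_{j+1}\le q$ (an empty condition if $n=1$). -/

import Mathlib

open Polynomial

noncomputable section

/-- The `q`-Pochhammer symbol `(a; q)_k = ∏_{j<k} (1 - a q^j)`. -/
def qPoch (a q : ℝ) (k : ℕ) : ℝ := ∏ j ∈ Finset.range k, (1 - a * q ^ j)

/-- The vector `q`-Pochhammer symbol: the product of `(a_i; q)_k` over the entries `a_i`. -/
def qPochList (as : List ℝ) (q : ℝ) (k : ℕ) : ℝ := (as.map fun a => qPoch a q k).prod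

/-- The terminating `q`-hypergeometric series `_{r+1}φ_s (q^{-n}, as; bs; q, x)`, as a polynomial
in `x`; here `r` and `s` are the lengths of `as` and `bs`. It is meaningful when no entry of `bs`
is one of `1, q⁻¹, …, q^{-(n-1)}`, so that the denominators do not vanish. -/
def qHypPoly (q : ℝ) (n : ℕ) (as bs : List ℝ) : ℝ[X] :=
  ∑ k ∈ Finset.range (n + 1),
    C (qPoch (q ^ (-(n : ℤ))) q k * qPochList as q k / qPochList bs q k
        * ((-1) ^ k * q ^ (k.choose 2)) ^ ((bs.length : ℤ) - (as.length : ℤ))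
        / qPoch q q k) * X ^ k

/-- The little `q`-Jacobi polynomial
`p_n(x; a, b | q) = _2φ_1 (q^{-n}, a b q^{n+1}; a q; q, q x)`. -/
def littleQJacobi (q : ℝ) (n : ℕ) (a b : ℝ) : ℝ[X] :=
  (qHypPoly q n [a * b * q ^ (n + 1)] [a * q]).comp (C q * X)

/-- `E_k(x) = ∏_{j=1}^k (1 - q^{-j} x)`. -/
def qE (q : ℝ) (k : ℕ) : ℝ[X] :=
  ∏ j ∈ Finset.Icc 1 k, (1 - C (q ^ (-(j : ℤ))) * X)

/-- `zerosList p` lists the real zeros of `p`, with multiplicity, in increasing order. -/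
def zerosList (p : ℝ[X]) : List ℝ := p.roots.sort (· ≤ ·)

/-- The logarithmic mesh of a polynomial whose zeros `λ_1 ≤ … ≤ λ_n` are all real and positive:
the maximum of `λ_j / λ_{j+1}` over `1 ≤ j ≤ n - 1`. If there are fewer than two zeros, there is
no ratio to bound, and the value is `0`. -/
def lmesh (p : ℝ[X]) : ℝ :=
  ⨆ j : Fin ((zerosList p).length - 1),
    (zerosList p).getD j 0 / (zerosList p).getD (j + 1) 0

/-- The nonzero real polynomials of degree at most `n` all of whose complex zeros lie in
the set `K` of real numbers. -/
def polyZerosIn (n : ℕ) (K : Set ℝ) : Set ℝ[X] :=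
  {p | p ≠ 0 ∧ p.natDegree ≤ n ∧ ∀ z : ℂ, aeval z p = 0 → ∃ x ∈ K, z = (x : ℂ)}

/-- The polynomials in `polyZerosIn n K` (`K` a set of positive reals) whose logarithmic mesh is
at most `q`. -/
def polyZerosInMeshLe (q : ℝ) (n : ℕ) (K : Set ℝ) : Set ℝ[X] :=
  {p | p ∈ polyZerosIn n K ∧ lmesh p ≤ q}

end

/-! The factorization is a gauge transformation. A first-order recurrence for coefficients is a
second-order `q`-difference equation (`qDifference_iff_coeff`), and $E(x)=E_k(qx)$ satisfies
$E(x)(1-qx)=E(qx)(1-q^{1-k}x)$. Multiplication by $E$ therefore turns the equation of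
$p_{n-k}(q^{-k}x;a,q^k)$ into that of $p_n(x;a,q^{-k})$, and the constant term $1$ singles out the
solution.

For the zeros, the backward shift builds $p_{m+1}(\cdot;a,b)$ from $p_m(\cdot;aq,bq)$. Sign changes
show that it preserves zeros in $(0,1]$ with consecutive ratios at most $q$
(`HasSparseZeros.backward_shift`). This covers $p_{n-k}(x;a,q^k)$, since $0\le q^k\le 1$. Passing to
$E_k(qx)\,p_{n-k}(q^{-k}x)$ amounts to $k$ rounds of multiplying all zeros by $q$ and adding the
zero $1$, which keeps the ratios at most $q$. -/

/-! ### Coefficients and the `q`-binomial theorem. -/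

theorem qPoch_succ (a q : ℝ) (i : ℕ) : qPoch a q (i + 1) = qPoch a q i * (1 - a * q ^ i) :=
  Finset.prod_range_succ _ _

theorem qPoch_succ' (a q : ℝ) (i : ℕ) :
    qPoch a q (i + 1) = (1 - a) * qPoch (a * q) q i := by
  unfold qPoch
  rw [Finset.prod_range_succ', pow_zero, mul_one, mul_comm]
  congr 1
  exact Finset.prod_congr rfl fun j _ => by ring

/-- The factor of index `n` vanishes. Hence the coefficient formulas below hold for every `i`,
without a cutoff at the degree. -/
theorem qPoch_inv_pow_eq_zero {q : ℝ} (hq : q ≠ 0) {n i : ℕ} (h : n < i) :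
    qPoch (q ^ n)⁻¹ q i = 0 :=
  Finset.prod_eq_zero (Finset.mem_range.2 h) (by rw [inv_mul_cancel₀ (pow_ne_zero _ hq), sub_self])

theorem qPoch_self_ne_zero {q : ℝ} (hq0 : 0 < q) (hq1 : q < 1) (i : ℕ) : qPoch q q i ≠ 0 :=
  Finset.prod_ne_zero_iff.2 fun j _ => by
    have := pow_lt_one₀ hq0.le hq1 (Nat.succ_ne_zero j)
    rw [← pow_succ']
    exact (sub_pos.2 this).ne'

theorem coeff_qHypPoly_nil {q : ℝ} (hq : q ≠ 0) (k i : ℕ) :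
    (qHypPoly q k [] []).coeff i = qPoch (q ^ k)⁻¹ q i / qPoch q q i := by
  simp only [qHypPoly, finsetSum_coeff, coeff_C_mul, coeff_X_pow, mul_ite, mul_one, mul_zero,
    Finset.sum_ite_eq, Finset.mem_range, qPochList, zpow_neg, zpow_natCast]
  split_ifs with h
  · simp
  · rw [qPoch_inv_pow_eq_zero hq (by omega), zero_div]

theorem coeff_littleQJacobi {q : ℝ} (hq : q ≠ 0) (n : ℕ) (a b : ℝ) (i : ℕ) :
    (littleQJacobi q n a b).coeff i =
      qPoch (q ^ n)⁻¹ q i * qPoch (a * b * q ^ (n + 1)) q i /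
        (qPoch (a * q) q i * qPoch q q i) * q ^ i := by
  rw [littleQJacobi, comp_C_mul_X_coeff]
  simp only [qHypPoly, finsetSum_coeff, coeff_C_mul, coeff_X_pow, mul_ite, mul_one, mul_zero,
    Finset.sum_ite_eq, Finset.mem_range, qPochList, zpow_neg, zpow_natCast]
  split_ifs with h
  · simp [div_div]
  · rw [qPoch_inv_pow_eq_zero hq (by omega)]; simp

theorem natDegree_littleQJacobi_le {q : ℝ} (hq : q ≠ 0) (n : ℕ) (a b : ℝ) :
    (littleQJacobi q n a b).natDegree ≤ n :=
  natDegree_le_iff_coeff_eq_zero.2 fun i hi => by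
    rw [coeff_littleQJacobi hq, qPoch_inv_pow_eq_zero hq hi]; simp

theorem qE_succ (q : ℝ) (k : ℕ) : qE q (k + 1) = qE q k * (1 - C (q ^ (k + 1))⁻¹ * X) := by
  rw [qE, Finset.prod_Icc_succ_top (by omega), zpow_neg, zpow_natCast]; rfl

/-- The terminating `q`-binomial theorem. -/
theorem qE_eq_qHypPoly {q : ℝ} (hq0 : 0 < q) (hq1 : q < 1) (k : ℕ) :
    qE q k = qHypPoly q k [] [] := by
  have hq := hq0.ne'
  induction k with
  | zero =>
    ext i
    rw [coeff_qHypPoly_nil hq]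
    cases i with
    | zero => simp [qE, qPoch]
    | succ i => rw [qPoch_inv_pow_eq_zero hq (by omega)]; simp [qE, coeff_one]
  | succ k ih =>
    ext i
    have hmul : qE q (k + 1) = qE q k - C (q ^ (k + 1))⁻¹ * (qE q k * X) := by
      rw [qE_succ]; ring
    rw [hmul, ih, coeff_sub, coeff_C_mul, coeff_qHypPoly_nil hq, coeff_qHypPoly_nil hq]
    cases i with
    | zero => simp [qPoch]
    | succ i =>
      rw [coeff_mul_X, coeff_qHypPoly_nil hq, qPoch_succ' (q ^ (k + 1))⁻¹,
        show (q ^ (k + 1))⁻¹ * q = (q ^ k)⁻¹ by field_simp; ring, qPoch_succ, qPoch_succ]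
      have h1 := qPoch_self_ne_zero hq0 hq1 i
      have h2 : 1 - q * q ^ i ≠ 0 := by
        have := qPoch_self_ne_zero hq0 hq1 (i + 1)
        rw [qPoch_succ] at this
        exact right_ne_zero_of_mul this
      have hqi := pow_ne_zero i hq
      have hqk := pow_ne_zero k hq
      rw [pow_succ q k]
      generalize qPoch (q ^ k)⁻¹ q i = s at *
      generalize qPoch q q i = u at *
      generalize q ^ i = x at *
      generalize q ^ k = y at *
      generalize hd : 1 - q * x = d at *
      field_simp
      rw [← hd]
      ring

/-! ### `q`-difference equations and the factorization. -/

theorem comp_C_mul_X_comp_C_mul_X (p : ℝ[X]) (r s : ℝ) :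
    (p.comp (C r * X)).comp (C s * X) = p.comp (C (r * s) * X) := by
  rw [comp_assoc]; simp [mul_assoc]

/-- Replacing `x` by `q x` shifts the index of every factor by one, so all but the two extreme
factors agree. -/
theorem qE_comp_mul {q : ℝ} (hq : q ≠ 0) (k : ℕ) :
    (qE q k).comp (C q * X) * (1 - C (q ^ k)⁻¹ * X) = qE q k * (1 - X) := by
  induction k with
  | zero => simp [qE]
  | succ k ih =>
    rw [qE_succ, mul_comp]
    have : (1 - C (q ^ (k + 1))⁻¹ * X : ℝ[X]).comp (C q * X) = 1 - C (q ^ k)⁻¹ * X := by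
      simp only [sub_comp, one_comp, mul_comp, C_comp, X_comp, ← mul_assoc, ← C_mul]
      congr 3
      field_simp
      ring
    rw [this]
    linear_combination (1 - C (q ^ (k + 1))⁻¹ * X) * ih

theorem qE_succ_comp {q : ℝ} (hq : q ≠ 0) (k : ℕ) :
    (qE q (k + 1)).comp (C q * X) = qE q k * (1 - X) := by
  rw [← qE_comp_mul hq, qE_succ, mul_comp]
  simp only [sub_comp, one_comp, mul_comp, C_comp, X_comp, ← mul_assoc, ← C_mul]
  congr 4
  field_simp
  ring

/-- A first-order recurrence for the coefficients is the same as a second-order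
`q`-difference equation. -/
theorem qDifference_iff_coeff (q a u α β : ℝ) (f : ℝ[X]) :
    f - C (1 + a) * f.comp (C q * X) + C a * f.comp (C (q * q) * X) =
        C u * (f - C (α + β) * f.comp (C q * X) + C (α * β) * f.comp (C (q * q) * X)) * X ↔
      ∀ i, (1 - a * q ^ (i + 1)) * (1 - q ^ (i + 1)) * f.coeff (i + 1) =
        u * (1 - α * q ^ i) * (1 - β * q ^ i) * f.coeff i := by
  rw [Polynomial.ext_iff]
  constructor
  · intro h i
    have := h (i + 1)
    simp only [coeff_mul_X, coeff_sub, coeff_add, coeff_C_mul, comp_C_mul_X_coeff, mul_pow] at this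
    linear_combination this
  · intro h i
    cases i with
    | zero =>
      simp only [coeff_sub, coeff_add, comp_C_mul_X_coeff, mul_coeff_zero, coeff_X_zero,
        coeff_C_zero, pow_zero]
      ring
    | succ i =>
      simp only [coeff_mul_X, coeff_sub, coeff_add, coeff_C_mul, comp_C_mul_X_coeff, mul_pow]
      linear_combination h i

theorem coeff_littleQJacobi_succ {q : ℝ} (hq0 : 0 < q) (hq1 : q < 1) (n : ℕ) (a b : ℝ)
    (ha : ∀ j < n, 1 - a * q ^ (j + 1) ≠ 0) (i : ℕ) :
    (1 - a * q ^ (i + 1)) * (1 - q ^ (i + 1)) * (littleQJacobi q n a b).coeff (i + 1) =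
      q * (1 - (q ^ n)⁻¹ * q ^ i) * (1 - a * b * q ^ (n + 1) * q ^ i) *
        (littleQJacobi q n a b).coeff i := by
  have hq := hq0.ne'
  simp only [coeff_littleQJacobi hq]
  rcases lt_or_ge i n with h | h
  · have h1 : qPoch (a * q) q i ≠ 0 := Finset.prod_ne_zero_iff.2 fun j hj => by
      have := ha j ((Finset.mem_range.1 hj).trans h)
      rwa [pow_succ', ← mul_assoc] at this
    have h2 := qPoch_self_ne_zero hq0 hq1 i
    have h3 : 1 - q * q ^ i ≠ 0 := by
      have := qPoch_self_ne_zero hq0 hq1 (i + 1)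
      rw [qPoch_succ] at this
      exact right_ne_zero_of_mul this
    have h4 : 1 - a * q * q ^ i ≠ 0 := by
      have := ha i h
      rwa [pow_succ', ← mul_assoc] at this
    simp only [qPoch_succ]
    rw [pow_succ' q i]
    field_simp
  -- Beyond the degree both sides vanish: for `i = n` through the factor $1-q^{-n}q^i$, for `i > n`
  -- through the coefficient itself. So `ha` is needed only below `n`.
  · rw [qPoch_inv_pow_eq_zero hq (by omega : n < i + 1)]
    rcases h.eq_or_lt with rfl | h
    · rw [inv_mul_cancel₀ (pow_ne_zero _ hq)]; simp
    · rw [qPoch_inv_pow_eq_zero hq h]; simp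

theorem coeff_zero_littleQJacobi {q : ℝ} (hq : q ≠ 0) (n : ℕ) (a b : ℝ) :
    (littleQJacobi q n a b).coeff 0 = 1 := by
  simp [coeff_littleQJacobi hq, qPoch]

theorem natDegree_qE_le (q : ℝ) (k : ℕ) : (qE q k).natDegree ≤ k := by
  induction k with
  | zero => simp [qE]
  | succ k ih =>
    rw [qE_succ]
    refine natDegree_mul_le.trans (add_le_add ih ?_)
    compute_degree

theorem natDegree_comp_C_mul_X_le (p : ℝ[X]) (r : ℝ) : (p.comp (C r * X)).natDegree ≤ p.natDegree :=
  natDegree_comp_le.trans (by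
    have : (C r * X : ℝ[X]).natDegree ≤ 1 := by compute_degree
    nlinarith)

/-- A terminating case of Heine's Euler-type transformation. -/
theorem littleQJacobi_inv_pow {q : ℝ} (hq0 : 0 < q) (hq1 : q < 1) {n k : ℕ} (hkn : k ≤ n) (a : ℝ)
    (ha : ∀ j < n, 1 - a * q ^ (j + 1) ≠ 0) :
    littleQJacobi q n a (q ^ k)⁻¹ =
      (qE q k).comp (C q * X) * (littleQJacobi q (n - k) a (q ^ k)).comp (C (q ^ k)⁻¹ * X) := by
  have hq := hq0.ne'
  obtain ⟨m, rfl⟩ := Nat.exists_eq_add_of_le' hkn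
  rw [Nat.add_sub_cancel]
  set G := (littleQJacobi q m a (q ^ k)).comp (C (q ^ k)⁻¹ * X) with hG
  set E := (qE q k).comp (C q * X) with hE
  have hGcoeff : ∀ i, (1 - a * q ^ (i + 1)) * (1 - q ^ (i + 1)) * G.coeff (i + 1) =
      (q * (q ^ k)⁻¹) * (1 - (q ^ m)⁻¹ * q ^ i) * (1 - a * q ^ k * q ^ (m + 1) * q ^ i) *
        G.coeff i := by
    intro i
    rw [hG, comp_C_mul_X_coeff, comp_C_mul_X_coeff, pow_succ (q ^ k)⁻¹]
    linear_combination ((q ^ k)⁻¹ ^ i * (q ^ k)⁻¹) * coeff_littleQJacobi_succ hq0 hq1 m a (q ^ k)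
      (fun j hj => ha j (by omega)) i
  have hGd := (qDifference_iff_coeff q a _ _ _ G).2 hGcoeff
  have hE1 : E * (1 - C q * X) = E.comp (C q * X) * (1 - C (q * (q ^ k)⁻¹) * X) := by
    have := congrArg (fun p : ℝ[X] => p.comp (C q * X)) (qE_comp_mul hq k)
    simp only [mul_comp, sub_comp, one_comp, X_comp, C_comp] at this
    rw [← hE, ← mul_assoc (C _), ← C_mul, mul_comm _ q] at this
    exact this.symm
  have hE2 : E.comp (C q * X) * (1 - C (q * q) * X) =
      E.comp (C (q * q) * X) * (1 - C (q * q * (q ^ k)⁻¹) * X) := by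
    have := congrArg (fun p : ℝ[X] => p.comp (C q * X)) hE1
    simp only [mul_comp, sub_comp, one_comp, X_comp, C_comp, comp_C_mul_X_comp_C_mul_X,
      ← mul_assoc, ← C_mul] at this
    rwa [show q * (q ^ k)⁻¹ * q = q * q * (q ^ k)⁻¹ by ring] at this
  have hqk := pow_ne_zero k hq
  have hqm := pow_ne_zero m hq
  have hFcoeff : ∀ i, (1 - a * q ^ (i + 1)) * (1 - q ^ (i + 1)) * (E * G).coeff (i + 1) =
      q * (1 - (q ^ (m + k))⁻¹ * q ^ i) * (1 - a * (q ^ k)⁻¹ * q ^ (m + k + 1) * q ^ i) *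
        (E * G).coeff i := by
    refine (qDifference_iff_coeff q a _ _ _ (E * G)).1 ?_
    simp only [mul_comp]
    have e1 : C (q * (q ^ k)⁻¹) * C ((q ^ m)⁻¹ + a * q ^ k * q ^ (m + 1)) =
        C q * C ((q ^ (m + k))⁻¹ + a * (q ^ k)⁻¹ * q ^ (m + k + 1)) := by
      rw [← C_mul, ← C_mul]; congr 1; field_simp; ring
    have e2 : C (q * (q ^ k)⁻¹) * C ((q ^ m)⁻¹ * (a * q ^ k * q ^ (m + 1))) =
        C a * C (q * q) := by
      rw [← C_mul, ← C_mul]; congr 1; field_simp; ring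
    have e3 : C q * C ((q ^ (m + k))⁻¹ * (a * (q ^ k)⁻¹ * q ^ (m + k + 1))) =
        C a * C (q * q * (q ^ k)⁻¹) := by
      rw [← C_mul, ← C_mul]; congr 1; field_simp; ring
    -- Grouped by shifts of $EG$, the outer terms contain $E(x)(1-qx)$ and $E(q^2x)(1-q^{2-k}x)$. By
    -- `hE1` and `hE2` both become multiples of $E(qx)$, leaving $E(qx)$ times the equation of $G$;
    -- `e1`, `e2`, `e3` match the constants.
    linear_combination (E.comp (C q * X)) * hGd + G * hE1
      - C a * G.comp (C (q * q) * X) * hE2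
      + E.comp (C q * X) * G.comp (C q * X) * X * (-e1)
      + E.comp (C q * X) * G.comp (C (q * q) * X) * X * e2
      - E.comp (C (q * q) * X) * G.comp (C (q * q) * X) * X * e3
  have hdeg : (E * G).natDegree ≤ m + k := by
    have h1 := (natDegree_comp_C_mul_X_le (qE q k) q).trans (natDegree_qE_le q k)
    have h2 := (natDegree_comp_C_mul_X_le (littleQJacobi q m a (q ^ k)) (q ^ k)⁻¹).trans
      (natDegree_littleQJacobi_le hq m a _)
    exact natDegree_mul_le.trans (by rw [add_comm m]; exact add_le_add h1 h2)
  -- The recurrence determines the next coefficient only while $1-aq^{i+1}\ne0$, which is known for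
  -- `i < m + k`; higher coefficients are handled by the degree bound `hdeg`.
  have key : ∀ i ≤ m + k, (littleQJacobi q (m + k) a (q ^ k)⁻¹).coeff i = (E * G).coeff i := by
    intro i
    induction i with
    | zero =>
      intro _
      have h0 : (qE q k).coeff 0 = 1 := by
        rw [qE_eq_qHypPoly hq0 hq1, coeff_qHypPoly_nil hq]; simp [qPoch]
      rw [mul_coeff_zero, hE, hG, comp_C_mul_X_coeff, comp_C_mul_X_coeff,
        coeff_zero_littleQJacobi hq, coeff_zero_littleQJacobi hq, h0]
      simp
    | succ i ih =>
      intro hi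
      have h1 := coeff_littleQJacobi_succ hq0 hq1 (m + k) a (q ^ k)⁻¹ ha i
      rw [ih (by omega), ← hFcoeff i] at h1
      refine mul_left_cancel₀ (mul_ne_zero (ha i (by omega)) ?_) h1
      exact (sub_pos.2 (pow_lt_one₀ hq0.le hq1 (Nat.succ_ne_zero i))).ne'
  ext i
  rcases le_or_gt i (m + k) with h | h
  · exact key i h
  · rw [coeff_eq_zero_of_natDegree_lt (hdeg.trans_lt h),
      coeff_eq_zero_of_natDegree_lt ((natDegree_littleQJacobi_le hq _ _ _).trans_lt h)]

/-! ### The backward shift. -/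

/-- The backward shift relation of the little `q`-Jacobi polynomials. -/
theorem littleQJacobi_backward_shift {q : ℝ} (hq0 : 0 < q) (hq1 : q < 1) (n : ℕ) {a : ℝ} (b : ℝ)
    (ha : ∀ j : ℕ, 1 - a * q * q ^ j ≠ 0) :
    C (a * q) * (C (b * q) * X - 1) * littleQJacobi q n (a * q) (b * q) -
        (X - 1) * (littleQJacobi q n (a * q) (b * q)).comp (C q⁻¹ * X) =
      C (1 - a * q) * littleQJacobi q (n + 1) a b := by
  have hq := hq0.ne'
  set p := littleQJacobi q n (a * q) (b * q) with hp
  have hrw : C (a * q) * (C (b * q) * X - 1) * p - (X - 1) * p.comp (C q⁻¹ * X) =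
      C (a * q * (b * q)) * p * X - C (a * q) * p - p.comp (C q⁻¹ * X) * X +
        p.comp (C q⁻¹ * X) := by
    rw [C_mul (a := a * q)]; ring
  rw [hrw]
  ext i
  cases i with
  | zero =>
    simp only [coeff_add, coeff_sub, comp_C_mul_X_coeff, mul_coeff_zero, coeff_X_zero]
    rw [hp, coeff_zero_littleQJacobi hq, coeff_zero_littleQJacobi hq]
    simp; ring
  | succ i =>
    simp only [coeff_add, coeff_sub, coeff_mul_X, coeff_C_mul, comp_C_mul_X_coeff]
    rw [hp]
    simp only [coeff_littleQJacobi hq]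
    rw [qPoch_succ' (q ^ (n + 1))⁻¹, show (q ^ (n + 1))⁻¹ * q = (q ^ n)⁻¹ by field_simp; ring,
      qPoch_succ' (a * b * q ^ (n + 1 + 1)), qPoch_succ' (a * q),
      show a * b * q ^ (n + 1 + 1) * q = a * q * (b * q) * q ^ (n + 1) by ring,
      qPoch_succ (q ^ n)⁻¹, qPoch_succ (a * q * (b * q) * q ^ (n + 1)), qPoch_succ q,
      qPoch_succ (a * q * q)]
    have h1 := qPoch_self_ne_zero hq0 hq1 i
    have h2 : 1 - q * q ^ i ≠ 0 := by
      have := qPoch_self_ne_zero hq0 hq1 (i + 1)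
      rw [qPoch_succ] at this
      exact right_ne_zero_of_mul this
    have h3 : 1 - a * q ≠ 0 := by simpa using ha 0
    have h4 : qPoch (a * q * q) q i ≠ 0 := Finset.prod_ne_zero_iff.2 fun j _ => by
      have := ha (j + 1)
      rwa [pow_succ', ← mul_assoc] at this
    have h5 : 1 - a * q ^ 2 * q ^ i ≠ 0 := by
      have := ha (i + 1)
      rwa [show a * q * q ^ (i + 1) = a * q ^ 2 * q ^ i by ring] at this
    rw [show a * q * q * q ^ i = a * q ^ 2 * q ^ i by ring]
    generalize qPoch (q ^ n)⁻¹ q i = s at *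
    generalize qPoch (a * q * (b * q) * q ^ (n + 1)) q i = t at *
    generalize qPoch q q i = u at *
    generalize qPoch (a * q * q) q i = v at *
    rw [pow_succ q⁻¹, inv_pow, pow_succ q i, pow_succ q (n + 1), pow_succ q n]
    have hqi := pow_ne_zero i hq
    have hqn := pow_ne_zero n hq
    generalize q ^ i = x at *
    generalize q ^ n = y at *
    field_simp
    ring

/-! ### Separation of the zeros. -/

/-- `p` has degree `n`, and its zeros `μ 0 < ⋯ < μ (n - 1)` lie in `(0, 1]` and satisfy
`μ i ≤ q * μ (i + 1)`. -/
def HasSparseZeros (q : ℝ) (n : ℕ) (p : ℝ[X]) : Prop :=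
  ∃ c : ℝ, c ≠ 0 ∧ ∃ μ : ℕ → ℝ, (∀ i < n, 0 < μ i ∧ μ i ≤ 1) ∧
    (∀ i, i + 1 < n → μ i ≤ q * μ (i + 1)) ∧ p = C c * ∏ i ∈ Finset.range n, (X - C (μ i))

theorem eq_C_mul_prod_of_natDegree_le {n : ℕ} {r : ℝ[X]} (hr : r ≠ 0) (hd : r.natDegree ≤ n)
    {μ : ℕ → ℝ} (hμ : Set.InjOn μ (Finset.range n)) (h0 : ∀ i < n, r.IsRoot (μ i)) :
    ∃ c : ℝ, c ≠ 0 ∧ r = C c * ∏ i ∈ Finset.range n, (X - C (μ i)) := by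
  have hdvd : ∏ i ∈ Finset.range n, (X - C (μ i)) ∣ r := by
    refine Finset.prod_dvd_of_coprime (fun i hi j hj hij => ?_) fun i hi =>
      dvd_iff_isRoot.2 (h0 i (Finset.mem_range.1 hi))
    exact isCoprime_X_sub_C_of_isUnit_sub (sub_ne_zero.2 fun h => hij (hμ hi hj h)).isUnit
  have hmonic : (∏ i ∈ Finset.range n, (X - C (μ i))).Monic :=
    monic_prod_of_monic _ _ fun i _ => monic_X_sub_C _
  obtain ⟨s, hs⟩ := hdvd
  have hs0 : s ≠ 0 := by rintro rfl; exact hr (by rw [hs, mul_zero])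
  have hdeg : (∏ i ∈ Finset.range n, (X - C (μ i))).natDegree = n := by
    rw [natDegree_prod_of_monic _ _ fun i _ => monic_X_sub_C _]; simp
  have hs1 : s.natDegree = 0 := by
    have := hmonic.natDegree_mul' hs0
    rw [← hs, hdeg] at this
    omega
  rw [eq_C_of_natDegree_eq_zero hs1] at hs hs0
  exact ⟨s.coeff 0, fun h => hs0 (by rw [h, C_0]), by rw [hs, mul_comm]⟩

theorem lt_of_sparse {q : ℝ} (hq1 : q < 1) {n : ℕ} {μ : ℕ → ℝ} (hpos : ∀ i < n, 0 < μ i)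
    (hμ : ∀ i, i + 1 < n → μ i ≤ q * μ (i + 1)) {i j : ℕ} (hij : i < j) (hj : j < n) :
    μ i < μ j := by
  induction j, hij using Nat.le_induction with
  | base => nlinarith [hμ i hj, hpos (i + 1) hj]
  | succ j _ ih => nlinarith [hμ j hj, hpos (j + 1) hj, ih (by omega)]

/-- The operator of the backward shift relation preserves the sparsity of the zeros: there is one
new zero in each of the intervals `[0, q μ₀]`, `[μ₀, q μ₁]`, …, `[μₙ₋₁, 1]`. -/
theorem HasSparseZeros.backward_shift {q a b : ℝ} (hq0 : 0 < q) (hq1 : q < 1) (ha0 : 0 < a)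
    (ha1 : a < 1) (hb0 : 0 ≤ b) (hb1 : b ≤ 1) {n : ℕ} {p r : ℝ[X]} (hp : HasSparseZeros q n p)
    (hr : r = C a * (C b * X - 1) * p - (X - 1) * p.comp (C q⁻¹ * X))
    (hd : r.natDegree ≤ n + 1) : HasSparseZeros q (n + 1) r := by
  obtain ⟨c, hc, lam, hmem, hsp, rfl⟩ := hp
  set p := C c * ∏ i ∈ Finset.range n, (X - C (lam i)) with hp
  have heval : ∀ x, p.eval x = c * ∏ i ∈ Finset.range n, (x - lam i) := fun x => by
    simp [hp, eval_prod]
  have hreval : ∀ x, r.eval x = (1 - x) * p.eval (x / q) - a * (1 - b * x) * p.eval x := fun x => by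
    rw [hr]; simp only [eval_sub, eval_mul, eval_C, eval_X, eval_one, eval_comp]
    rw [inv_mul_eq_div]; ring
  have hmono : ∀ i j, i ≤ j → j < n → lam i ≤ lam j := fun i j hij hj => by
    rcases hij.eq_or_lt with rfl | hij
    · exact le_rfl
    · exact (lt_of_sparse hq1 (fun i hi => (hmem i hi).1) hsp hij hj).le
  -- $r(0)=(1-a)p(0)\ne0$ shows that `r` is nonzero and that the zero found in the first closed
  -- interval is positive.
  have hr0 : r.eval 0 ≠ 0 := by
    rw [hreval, zero_div, heval]
    have h1 : ∏ i ∈ Finset.range n, (0 - lam i) ≠ 0 := Finset.prod_ne_zero_iff.2 fun i hi => by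
      have := (hmem i (Finset.mem_range.1 hi)).1
      linarith
    have h2 : 1 - a ≠ 0 := by linarith
    have := mul_ne_zero h2 (mul_ne_zero hc h1)
    intro h
    exact this (by linear_combination h)
  set lo : ℕ → ℝ := fun j => if j = 0 then 0 else lam (j - 1) with hlo
  set hi : ℕ → ℝ := fun j => if j < n then q * lam j else 1 with hhi
  have hlohi : ∀ j ≤ n, 0 ≤ lo j ∧ lo j ≤ hi j ∧ hi j ≤ 1 := by
    intro j hj
    simp only [hlo, hhi]
    split_ifs with h1 h2 h2
    · have := hmem j h2
      exact ⟨le_rfl, by nlinarith, by nlinarith⟩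
    · exact ⟨le_rfl, zero_le_one, le_rfl⟩
    · have := hmem j h2
      have h3 := hsp (j - 1) (by omega)
      rw [show j - 1 + 1 = j by omega] at h3
      exact ⟨(hmem (j - 1) (by omega)).1.le, h3, by nlinarith⟩
    · have := hmem (j - 1) (by omega)
      exact ⟨this.1.le, this.2, le_rfl⟩
  have hex : ∀ j, ∃ x, j ≤ n → lo j ≤ x ∧ x ≤ hi j ∧ r.eval x = 0 := by
    intro j
    by_cases hj : j ≤ n
    swap
    · exact ⟨0, fun h => absurd h hj⟩
    obtain ⟨l0, lh, h1⟩ := hlohi j hj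
    -- At each endpoint one term of `r` drops out: $p$ vanishes at `lo j` for `j > 0`, and $p(x/q)$
    -- vanishes at `hi j` for `j < n`. At $0$ the two terms merge, and at $1$ the factor $1-x$
    -- vanishes.
    have hplo : ∃ A : ℝ, 0 ≤ A ∧ r.eval (lo j) = A * p.eval (lo j / q) := by
      by_cases h : j = 0
      · refine ⟨1 - a, by linarith, ?_⟩
        rw [hreval, show lo j = 0 by simp [hlo, h], zero_div]; ring
      · refine ⟨1 - lo j, by linarith, ?_⟩
        rw [hreval, heval (lo j), Finset.prod_eq_zero (i := j - 1) (Finset.mem_range.2 (by omega))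
          (by simp [hlo, h])]
        ring
    have hphi : ∃ B : ℝ, 0 ≤ B ∧ r.eval (hi j) = -B * p.eval (hi j) := by
      refine ⟨a * (1 - b * hi j), mul_nonneg ha0.le (by nlinarith), ?_⟩
      by_cases h : j < n
      · have h2 : hi j / q = lam j := by
          simp only [hhi, if_pos h]; field_simp
        rw [hreval, h2, heval (lam j), Finset.prod_eq_zero (i := j) (Finset.mem_range.2 h)
          (sub_self _)]
        ring
      · rw [hreval, show hi j = 1 by simp [hhi, h]]; ring
    -- The points `lo j / q` and `hi j` lie weakly on the same side of every zero of `p`: above `lam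
    -- i` for `i < j`, below it for `i ≥ j`.
    have hpp : 0 ≤ p.eval (lo j / q) * p.eval (hi j) := by
      rw [heval, heval, show ∀ u v : ℝ, c * u * (c * v) = c ^ 2 * (u * v) by intros; ring,
        ← Finset.prod_mul_distrib]
      refine mul_nonneg (sq_nonneg c) (Finset.prod_nonneg fun i hi' => ?_)
      have hi' := Finset.mem_range.1 hi'
      have hlq : lo j ≤ lo j / q := le_div_self l0 hq0 hq1.le
      rcases lt_or_ge i j with hij | hij
      · have h2 : lam i ≤ lo j := by
          simp only [hlo, if_neg (by omega : j ≠ 0)]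
          exact hmono _ _ (by omega) (by omega)
        exact mul_nonneg (by linarith) (by linarith)
      · have h2 : hi j ≤ q * lam i := by
          simp only [hhi, if_pos (by omega : j < n)]
          exact mul_le_mul_of_nonneg_left (hmono _ _ hij hi') hq0.le
        have h3 : lo j / q ≤ lam i := by rw [div_le_iff₀ hq0]; linarith
        have h4 := (hmem i hi').1
        exact mul_nonneg_of_nonpos_of_nonpos (by linarith) (by nlinarith)
    obtain ⟨A, hA, hA'⟩ := hplo
    obtain ⟨B, hB, hB'⟩ := hphi
    have hsign : r.eval (lo j) * r.eval (hi j) ≤ 0 := by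
      rw [hA', hB']
      have := mul_nonneg (mul_nonneg hA hB) hpp
      linarith
    have hcont : ContinuousOn (fun x => r.eval x) (Set.Icc (lo j) (hi j)) :=
      r.continuous.continuousOn
    rcases mul_nonpos_iff.1 hsign with ⟨h2, h3⟩ | ⟨h2, h3⟩
    · obtain ⟨x, hx, hx0⟩ := intermediate_value_Icc' lh hcont ⟨h3, h2⟩
      exact ⟨x, fun _ => ⟨hx.1, hx.2, hx0⟩⟩
    · obtain ⟨x, hx, hx0⟩ := intermediate_value_Icc lh hcont ⟨h2, h3⟩
      exact ⟨x, fun _ => ⟨hx.1, hx.2, hx0⟩⟩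
  choose μ hμ using hex
  have hμmem : ∀ i < n + 1, 0 < μ i ∧ μ i ≤ 1 := fun i h => by
    obtain ⟨h1, h2, h3⟩ := hμ i (by omega)
    obtain ⟨h4, h5, h6⟩ := hlohi i (by omega)
    refine ⟨lt_of_le_of_ne (h4.trans h1) fun h0 => hr0 ?_, h2.trans h6⟩
    rwa [← h0] at h3
  -- The old zero separates the new ones: `μ i ≤ q * lam i ≤ q * μ (i + 1)`. With positivity this
  -- makes the `μ i` distinct, although the intervals are closed.
  have hμsp : ∀ i, i + 1 < n + 1 → μ i ≤ q * μ (i + 1) := fun i h => by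
    have h1 := (hμ i (by omega)).2.1
    have h2 := (hμ (i + 1) (by omega)).1
    simp only [hhi, if_pos (by omega : i < n)] at h1
    simp only [hlo, if_neg (Nat.succ_ne_zero i), Nat.add_sub_cancel] at h2
    nlinarith
  have hinj : Set.InjOn μ (Finset.range (n + 1)) := by
    intro i hi' j hj' hij
    have hi' : i < n + 1 := by simpa using hi'
    have hj' : j < n + 1 := by simpa using hj'
    by_contra hne
    rcases Nat.lt_or_gt_of_ne hne with h | h
    · exact (lt_of_sparse hq1 (fun i hi => (hμmem i hi).1) hμsp h hj').ne hij
    · exact (lt_of_sparse hq1 (fun i hi => (hμmem i hi).1) hμsp h hi').ne' hij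
  obtain ⟨c', hc', hr'⟩ := eq_C_mul_prod_of_natDegree_le (fun h => hr0 (by rw [h, eval_zero])) hd
    hinj fun i hi' => (hμ i (by omega)).2.2
  exact ⟨c', hc', μ, hμmem, hμsp, hr'⟩

theorem HasSparseZeros.of_C_mul {q : ℝ} {n : ℕ} {p : ℝ[X]} {d : ℝ} (hd : d ≠ 0)
    (h : HasSparseZeros q n (C d * p)) : HasSparseZeros q n p := by
  obtain ⟨c, hc, μ, h1, h2, h3⟩ := h
  refine ⟨d⁻¹ * c, mul_ne_zero (inv_ne_zero hd) hc, μ, h1, h2, ?_⟩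
  rw [C_mul, mul_assoc, ← h3, ← mul_assoc, ← C_mul, inv_mul_cancel₀ hd, C_1, one_mul]

/-- The parameters are quantified inside the induction because the shift replaces `(a, b)` by `(a q,
b q)`; the stated range is stable under this. -/
theorem hasSparseZeros_littleQJacobi {q : ℝ} (hq0 : 0 < q) (hq1 : q < 1) (n : ℕ) :
    ∀ a b : ℝ, 0 < a * q → a * q < 1 → 0 ≤ b → b ≤ 1 →
      HasSparseZeros q n (littleQJacobi q n a b) := by
  have hq := hq0.ne'
  induction n with
  | zero =>
    intro a b _ _ _ _
    refine ⟨1, one_ne_zero, fun _ => 1, by simp, by simp, ?_⟩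
    rw [eq_C_of_natDegree_le_zero (natDegree_littleQJacobi_le hq 0 a b),
      coeff_zero_littleQJacobi hq]
    simp
  | succ n ih =>
    intro a b ha0 ha1 hb0 hb1
    have hbq1 : b * q ≤ 1 := by nlinarith
    have hshift := littleQJacobi_backward_shift hq0 hq1 n b (a := a) fun j => by
      have := pow_le_one₀ (n := j) hq0.le hq1.le
      have := mul_le_mul_of_nonneg_left this ha0.le
      exact (sub_pos.2 (by linarith)).ne'
    refine .of_C_mul (sub_pos.2 ha1).ne' ?_
    refine (ih (a * q) (b * q) (by positivity) (by nlinarith) (by positivity) hbq1).backward_shift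
      hq0 hq1 ha0 ha1 (by positivity) hbq1 hshift.symm ?_
    exact (natDegree_C_mul_le _ _).trans (natDegree_littleQJacobi_le hq _ _ _)

/-! ### Adjoining the zeros of $E_k(qx)$. -/

/-- All zeros are at most $1$, so after scaling by $q$ they are at most $q$ times the new zero $1$;
the old ratios do not change. -/
theorem HasSparseZeros.comp_mul_one_sub_X {q : ℝ} (hq0 : 0 < q) (hq1 : q < 1) {n : ℕ} {p : ℝ[X]}
    (hp : HasSparseZeros q n p) :
    HasSparseZeros q (n + 1) (p.comp (C q⁻¹ * X) * (1 - X)) := by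
  obtain ⟨c, hc, μ, h1, h2, rfl⟩ := hp
  refine ⟨-c * (q⁻¹) ^ n, mul_ne_zero (neg_ne_zero.2 hc) (pow_ne_zero _ (inv_ne_zero hq0.ne')),
    fun i => if i < n then q * μ i else 1, fun i hi => ?_, fun i hi => ?_, ?_⟩
  · dsimp only
    split_ifs with h
    · have := h1 i h
      exact ⟨mul_pos hq0 this.1, by nlinarith⟩
    · exact ⟨one_pos, le_rfl⟩
  · dsimp only
    rw [if_pos (by omega)]
    split_ifs with h
    · exact mul_le_mul_of_nonneg_left (h2 i h) hq0.le
    · exact mul_le_mul_of_nonneg_left (h1 i (by omega)).2 hq0.le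
  · have hprod : (∏ i ∈ Finset.range n, (X - C (μ i))).comp (C q⁻¹ * X) =
        C (q⁻¹ ^ n) * ∏ i ∈ Finset.range n, (X - C (if i < n then q * μ i else 1)) := by
      rw [prod_comp, C_pow, ← Finset.card_range n, ← Finset.prod_const, Finset.card_range,
        ← Finset.prod_mul_distrib]
      refine Finset.prod_congr rfl fun i hi => ?_
      rw [if_pos (Finset.mem_range.1 hi), mul_sub, ← C_mul, inv_mul_cancel_left₀ hq0.ne']
      simp
    rw [mul_comp, C_comp, hprod, Finset.prod_range_succ]
    dsimp only
    rw [if_neg (lt_irrefl n), C_mul, C_neg, C_1]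
    ring

theorem HasSparseZeros.qE_mul {q : ℝ} (hq0 : 0 < q) (hq1 : q < 1) {n : ℕ} {p : ℝ[X]}
    (hp : HasSparseZeros q n p) (k : ℕ) :
    HasSparseZeros q (n + k) ((qE q k).comp (C q * X) * p.comp (C (q ^ k)⁻¹ * X)) := by
  induction k with
  | zero => simpa [qE] using hp
  | succ k ih =>
    -- Substituting $q^{-1}x$ turns $E_k(qx)$ into $E_k(x)$, and $E_k(x)(1-x)=E_{k+1}(qx)$.
    have h := ih.comp_mul_one_sub_X hq0 hq1
    rw [mul_comp, comp_C_mul_X_comp_C_mul_X, comp_C_mul_X_comp_C_mul_X, mul_inv_cancel₀ hq0.ne',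
      C_1, one_mul, comp_X, ← mul_inv, ← pow_succ] at h
    rw [qE_succ_comp hq0.ne']
    rwa [mul_right_comm] at h

/-! ### Degree, complex zeros and logarithmic mesh. -/

theorem HasSparseZeros.natDegree_eq {q : ℝ} {n : ℕ} {p : ℝ[X]} (hp : HasSparseZeros q n p) :
    p.natDegree = n := by
  obtain ⟨c, hc, μ, -, -, rfl⟩ := hp
  rw [natDegree_C_mul hc, natDegree_prod_of_monic _ _ fun i _ => monic_X_sub_C _]
  simp

theorem HasSparseZeros.mem_polyZerosInMeshLe {q : ℝ} (hq0 : 0 < q) (hq1 : q < 1) {n : ℕ} {p : ℝ[X]}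
    (hp : HasSparseZeros q n p) : p ∈ polyZerosInMeshLe q n (Set.Ioc 0 1) := by
  have hdeg := hp.natDegree_eq
  obtain ⟨c, hc, μ, h1, h2, rfl⟩ := hp
  have hprod : ∏ i ∈ Finset.range n, (X - C (μ i)) ≠ 0 :=
    Finset.prod_ne_zero_iff.2 fun i _ => X_sub_C_ne_zero _
  refine ⟨⟨mul_ne_zero (C_ne_zero.2 hc) hprod, hdeg.le, fun z hz => ?_⟩, ?_⟩
  · rw [map_mul, aeval_C, map_prod] at hz
    have hc' : algebraMap ℝ ℂ c ≠ 0 := by simpa using hc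
    obtain ⟨i, hi, hz⟩ := Finset.prod_eq_zero_iff.1 ((mul_eq_zero.1 hz).resolve_left hc')
    refine ⟨μ i, h1 i (Finset.mem_range.1 hi), ?_⟩
    simpa [sub_eq_zero] using hz
  · have hlist : zerosList (C c * ∏ i ∈ Finset.range n, (X - C (μ i))) =
        (List.range n).map μ := by
      have hroots : (C c * ∏ i ∈ Finset.range n, (X - C (μ i))).roots =
          ((List.range n).map μ : List ℝ) := by
        rw [roots_C_mul _ hc, roots_prod _ _ hprod]
        simp [Multiset.bind_singleton, Finset.range, Multiset.range]
      rw [zerosList, hroots]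
      refine List.Perm.eq_of_pairwise' (r := (· ≤ ·)) (Multiset.pairwise_sort _ _) ?_
        (Multiset.coe_eq_coe.1 (Multiset.sort_eq _ _))
      rw [List.pairwise_map]
      refine (List.pairwise_lt_range (n := n)).imp_of_mem fun {i j} _ hj hij => ?_
      exact (lt_of_sparse hq1 (fun i hi => (h1 i hi).1) h2 hij (List.mem_range.1 hj)).le
    rw [lmesh, hlist]
    -- With fewer than two zeros the supremum is empty and equals `0`, hence the appeal to `0 ≤ q`.
    refine Real.iSup_le (fun j => ?_) hq0.le
    have hj : (j : ℕ) + 1 < n := by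
      have := j.2
      simp only [List.length_map, List.length_range] at this
      omega
    have hget : ∀ i < n, ((List.range n).map μ).getD i 0 = μ i := fun i hi => by
      simp [List.getD, hi]
    rw [hget _ (by omega), hget _ hj, div_le_iff₀ (h1 _ hj).1]
    exact h2 _ hj

theorem mainTheorem5 (q : ℝ) (hq0 : 0 < q) (hq1 : q < 1) (n k : ℕ) (hk1 : 1 ≤ k) (hkn : k ≤ n) :
    qE q k = qHypPoly q k [] [] ∧
    (∀ a : ℝ, (∀ j ∈ Finset.Icc 1 n, a ≠ q ^ (-(j : ℤ))) →
      littleQJacobi q n a (q ^ (-(k : ℤ))) =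
        (qE q k).comp (C q * X) *
          (littleQJacobi q (n - k) a (q ^ k)).comp (C (q ^ (-(k : ℤ))) * X)) ∧
    (∀ a : ℝ, 0 < a * q → a * q < 1 →
      (littleQJacobi q n a (q ^ (-(k : ℤ)))).natDegree = n ∧
      littleQJacobi q n a (q ^ (-(k : ℤ))) ∈ polyZerosInMeshLe q n (Set.Ioc 0 1)) := by
  simp only [zpow_neg, zpow_natCast]
  refine ⟨qE_eq_qHypPoly hq0 hq1 k, fun a ha => ?_, fun a ha0 ha1 => ?_⟩
  · refine littleQJacobi_inv_pow hq0 hq1 hkn a fun j hj h => ?_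
    exact ha (j + 1) (Finset.mem_Icc.2 ⟨by omega, by omega⟩)
      (eq_inv_of_mul_eq_one_left (sub_eq_zero.1 h).symm)
  · have hfac := littleQJacobi_inv_pow hq0 hq1 hkn a fun j _ => by
      have := mul_le_mul_of_nonneg_left (pow_le_one₀ (n := j) hq0.le hq1.le) ha0.le
      rw [pow_succ', ← mul_assoc]
      exact (sub_pos.2 (by linarith)).ne'
    have hsparse := (hasSparseZeros_littleQJacobi hq0 hq1 (n - k) a (q ^ k) ha0 ha1
      (by positivity) (pow_le_one₀ hq0.le hq1.le)).qE_mul hq0 hq1 k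
    rw [← hfac, Nat.sub_add_cancel hkn] at hsparse
    exact ⟨hsparse.natDegree_eq, hsparse.mem_polyZerosInMeshLe hq0 hq1⟩
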